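/- Notation. Let $n\ge 1$, $r,s\ge 0$, and let $n_1,\dots,n_r,m_1,\dots,m_s$ be positive integers with $(n_1+\dots+n_r)+2(m_1+\dots+m_s)=n$; write $\eta=(n_1,\dots,n_r;m_1,\dots,m_s)$. Let $\mathbb T_m(\mathbb R)$ be the set of real lower triangular $m\times m$ matrices with all diagonal entries equal. Let $\mathbb S$ be the set of matrices $\begin{bmatrix}\alpha&\beta\\-\beta&\alpha\end{bmatrix}$ with $\alpha,\beta\in\mathbb R$, and let $\mathbb B_m(\mathbb R)$ be the set of real $2m\times 2m$ matrices that are block lower triangular with $2\times2$ blocks in $\mathbb S$ and with all diagonal blocks equal. Put $$\mathcal K_{\eta,r,s}(\mathbb R)=\mathbb T_{n_1}(\mathbb R)\oplus\dots\oplus\mathbb T_{n_r}(\mathbb R)\oplus\mathbb B_{m_1}(\mathbb R)\oplus\dots\oplus\mathbb B_{m_s}(\mathbb R)$$ (block diagonal matrices), and $\mathcal K^*_{\eta,r,s}(\mathbb R)=\mathcal K_{\eta,r,s}(\mathbb R)\cap \mathrm{GL}(n,\mathbb R)$. Let $u_0\in\mathbb R^n$ be the vector whose component in each of the $r+s$ blocks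 is the first standard unit vector $[1,0,\dots,0]^T$ of that block. For $1\le l\le s$ let $f^{(l)}\in\mathbb R^n$ be the vector whose component in the block of $\mathbb B_{m_l}(\mathbb R)$ is $[0,1,0,\dots,0]^T\in\mathbb R^{2m_l}$ and whose other components vanish. For a subgroup $G$ of $\mathrm{GL}(n,\mathbb R)$ and $v\in\mathbb R^n$ let $G(v)=\{Av: A\in G\}$ be the orbit of $v$; a subset of $\mathbb R^n$ is called locally dense if its closure has nonempty interior. Theorem. Let $G$ be an abelian subgroup of $\mathrm{GL}(n,\mathbb R)$ and let $P\in \mathrm{GL}(n,\mathbb R)$ be such that $P^{-1}GP\subset\mathcal K^*_{\eta,r,s}(\mathbb R)$. Put $v_0=Pu_0$, $\mathrm g=\exp^{-1}(G)\cap P\,\mathcal K_{\eta,r,s}(\mathbb R)P^{-1}$, $G^2=\{A^2:A\in G\}$, $\mathrm g^2=\exp^{-1}(G^2)\cap P\,\mathcal K_{\eta,r,s}(\mathbb R)P^{-1}$ and $\mathrm g^2_{v_0}=\{Bv_0: B\in \mathrm g^2\}$, where $\exp(M)=e^M$ is the matrix exponential on the real $n\times n$ matrices. Let $A_1,\dots,A_p$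 generate $G$, and let $B_1,\dots,B_p\in \mathrm g$ satisfy $A_1^2=e^{B_1},\dots,A_p^2=e^{B_p}$. Then $$\mathrm g^2_{v_0}=\sum_{k=1}^p\mathbb Z\,(B_kv_0)+\sum_{l=1}^s2\pi\mathbb Z\,Pf^{(l)},$$ and the following properties are equivalent: (i) $G$ has a locally dense orbit in $\mathbb R^n$, that is, $G(v)$ is locally dense for some $v\in\mathbb R^n$; (ii) $G(v_0)$ is locally dense in $\mathbb R^n$; (iii) the additive subgroup $\sum_{k=1}^p\mathbb Z\,(B_kv_0)+\sum_{l=1}^s2\pi\mathbb Z\,Pf^{(l)}$ is dense in $\mathbb R^n$. -/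

import Mathlib

open scoped Matrix

noncomputable section

namespace AbelianLinear

/-- A partition `η = (n₁,…,n_r; m₁,…,m_s)` of `n`: positive integers with
`(n₁ + ⋯ + n_r) + 2 (m₁ + ⋯ + m_s) = n`. Either of `r`, `s` may be zero. -/
structure Partition (n r s : ℕ) where
  /-- the sizes `n₁,…,n_r` of the real blocks -/
  realSize : Fin r → ℕ
  /-- the half-sizes `m₁,…,m_s` of the complex blocks -/
  cplxSize : Fin s → ℕ
  realSize_pos : ∀ k, 0 < realSize k
  cplxSize_pos : ∀ l, 0 < cplxSize l
  sum_eq : ∑ k, realSize k + 2 * ∑ l, cplxSize l = n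

namespace Partition

variable {n r s : ℕ} (η : Partition n r s)

/-- Positions inside the blocks: `inl ⟨k, a⟩` is the `a`-th coordinate of the `k`-th real block, and
`inr ⟨l, (j, c)⟩` is the `(2j + c)`-th coordinate of the `l`-th complex block, with `c ∈ {0, 1}`
(everything counted from `0`). -/
abbrev Index : Type :=
  (Σ k : Fin r, Fin (η.realSize k)) ⊕ (Σ l : Fin s, Fin (η.cplxSize l) × Fin 2)

/-- The enumeration of the positions in the order of the blocks. -/
def indexEquiv : η.Index ≃ Fin n :=
  (Equiv.sumCongr finSigmaFinEquiv
    ((Equiv.sigmaCongrRight fun _ => finProdFinEquiv).trans finSigmaFinEquiv)).trans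
    (finSumFinEquiv.trans (finCongr (by
      rw [← Finset.sum_mul, Nat.mul_comm _ 2]
      exact η.sum_eq)))

end Partition

/-- `𝕋_m(ℝ)`: lower triangular matrices with constant diagonal. -/
def TSet (m : ℕ) : Set (Matrix (Fin m) (Fin m) ℝ) :=
  {M | (∀ i j, i < j → M i j = 0) ∧ ∃ μ : ℝ, ∀ i, M i i = μ}

/-- `𝕊`: real matrices of the form `[[α, β], [-β, α]]`. -/
def SSet : Set (Matrix (Fin 2) (Fin 2) ℝ) :=
  {C | ∃ α β : ℝ, C = !![α, β; -β, α]}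

/-- `𝔹_m(ℝ)`: the `2m × 2m` matrices that are block lower triangular with `2 × 2` blocks in `𝕊` and
constant diagonal block. The index `(i, a)` stands for the row or column `2i + a`. -/
def BSet (m : ℕ) : Set (Matrix (Fin m × Fin 2) (Fin m × Fin 2) ℝ) :=
  {M | ∃ D : Fin m → Fin m → Matrix (Fin 2) (Fin 2) ℝ,
    (∀ i j a b, M (i, a) (j, b) = D i j a b) ∧
    (∀ i j, D i j ∈ SSet) ∧
    (∀ i j, i < j → D i j = 0) ∧
    ∃ C, ∀ i, D i i = C}

variable {n r s : ℕ}

/-- `𝒦_{η,r,s}(ℝ)`: block diagonal matrices with diagonal blocks, in this order, in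
`𝕋_{n₁}(ℝ), …, 𝕋_{n_r}(ℝ), 𝔹_{m₁}(ℝ), …, 𝔹_{m_s}(ℝ)`. -/
def KSet (η : Partition n r s) : Set (Matrix (Fin n) (Fin n) ℝ) :=
  {M | ∃ (T : ∀ k, Matrix (Fin (η.realSize k)) (Fin (η.realSize k)) ℝ)
      (D : ∀ l, Matrix (Fin (η.cplxSize l) × Fin 2) (Fin (η.cplxSize l) × Fin 2) ℝ),
    (∀ k, T k ∈ TSet (η.realSize k)) ∧ (∀ l, D l ∈ BSet (η.cplxSize l)) ∧
    M.submatrix η.indexEquiv η.indexEquiv =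
      Matrix.fromBlocks (Matrix.blockDiagonal' T) 0 0 (Matrix.blockDiagonal' D)}

/-- `𝒦*_{η,r,s}(ℝ) = 𝒦_{η,r,s}(ℝ) ∩ GL(n, ℝ)`. -/
def KStar (η : Partition n r s) : Set (GL (Fin n) ℝ) :=
  {M | (M : Matrix (Fin n) (Fin n) ℝ) ∈ KSet η}

/-- `P 𝒦_{η,r,s}(ℝ) P⁻¹`. -/
def conjKSet (η : Partition n r s) (P : GL (Fin n) ℝ) : Set (Matrix (Fin n) (Fin n) ℝ) :=
  (fun M => (P : Matrix (Fin n) (Fin n) ℝ) * M * ((P⁻¹ : GL (Fin n) ℝ) : Matrix (Fin n) (Fin n) ℝ))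
    '' KSet η

/-- `exp⁻¹(S) ∩ P 𝒦_{η,r,s}(ℝ) P⁻¹` for a set `S` of invertible matrices. -/
def logSet (η : Partition n r s) (P : GL (Fin n) ℝ) (S : Set (GL (Fin n) ℝ)) :
    Set (Matrix (Fin n) (Fin n) ℝ) :=
  {B | (∃ A ∈ S, NormedSpace.exp B = (A : Matrix (Fin n) (Fin n) ℝ)) ∧ B ∈ conjKSet η P}

/-- `g = exp⁻¹(G) ∩ P 𝒦_{η,r,s}(ℝ) P⁻¹`. -/
def g (η : Partition n r s) (P : GL (Fin n) ℝ) (G : Subgroup (GL (Fin n) ℝ)) :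
    Set (Matrix (Fin n) (Fin n) ℝ) :=
  logSet η P (G : Set (GL (Fin n) ℝ))

/-- `g² = exp⁻¹(G²) ∩ P 𝒦_{η,r,s}(ℝ) P⁻¹`, where `G² = {A² : A ∈ G}`. -/
def gSq (η : Partition n r s) (P : GL (Fin n) ℝ) (G : Subgroup (GL (Fin n) ℝ)) :
    Set (Matrix (Fin n) (Fin n) ℝ) :=
  logSet η P {A | ∃ A' ∈ G, A = A' ^ 2}

/-- `{B u : B ∈ S}`. -/
def evalSet (S : Set (Matrix (Fin n) (Fin n) ℝ)) (u : Fin n → ℝ) : Set (Fin n → ℝ) :=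
  (fun B => B *ᵥ u) '' S

/-- The orbit `G(v) = {A v : A ∈ G}`. -/
def orbit (G : Subgroup (GL (Fin n) ℝ)) (v : Fin n → ℝ) : Set (Fin n → ℝ) :=
  {w | ∃ A ∈ G, w = (A : Matrix (Fin n) (Fin n) ℝ) *ᵥ v}

/-- A subset of `ℝⁿ` is locally dense if its closure has nonempty interior. -/
def LocallyDense (E : Set (Fin n → ℝ)) : Prop :=
  (interior (closure E)).Nonempty

/-- `u₀`: the vector whose component in each block is the first unit vector of that block. -/
def u₀ (η : Partition n r s) : Fin n → ℝ := fun i =>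
  match η.indexEquiv.symm i with
  | Sum.inl ⟨_, a⟩ => if (a : ℕ) = 0 then 1 else 0
  | Sum.inr ⟨_, (j, c)⟩ => if (j : ℕ) = 0 ∧ c = 0 then 1 else 0

/-- `v₀ = P u₀`. -/
def v₀ (η : Partition n r s) (P : GL (Fin n) ℝ) : Fin n → ℝ :=
  (P : Matrix (Fin n) (Fin n) ℝ) *ᵥ u₀ η

/-- `f^{(l)}`: the vector whose component in the `l`-th complex block is the second unit vector
`[0, 1, 0, …, 0]ᵀ` of that block and whose other components are zero. -/
def f (η : Partition n r s) (l : Fin s) : Fin n → ℝ := fun i =>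
  match η.indexEquiv.symm i with
  | Sum.inl _ => 0
  | Sum.inr ⟨l', (j, c)⟩ => if l' = l ∧ (j : ℕ) = 0 ∧ c = 1 then 1 else 0

/-- `∑_k ℤ (B_k v₀) + ∑_l 2πℤ P f^{(l)}`. -/
def explicitSubgroup (η : Partition n r s) (P : GL (Fin n) ℝ) {p : ℕ}
    (B : Fin p → Matrix (Fin n) (Fin n) ℝ) : Set (Fin n → ℝ) :=
  {x | ∃ (a : Fin p → ℤ) (t : Fin s → ℤ),
    x = ∑ k, (a k : ℝ) • (B k *ᵥ v₀ η P) +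
      ∑ l, (2 * Real.pi * (t l : ℝ)) • ((P : Matrix (Fin n) (Fin n) ℝ) *ᵥ f η l)}

end AbelianLinear

end

/-! The algebra `P 𝒦 P⁻¹` (`conjAlgebra`) splits as scalars from `ℝ^r × ℂ^s` plus a nilpotent part
commuting with those scalars. On it `exp` is therefore understood: on nilpotent elements it is
injective, and commutation of exponentials implies commutation (`commute_of_commute_exp`). Two
logarithms of the same matrix differ by a period `2π ∑ t_l J_l`, where `J_l` is multiplication by
`i` on the `l`-th complex block (`exists_eq_add_of_exp_eq`). Hence the `B_k` commute, their integral
combinations plus periods are exactly `g²` (`gSq_eq`), and evaluating at `v₀` gives the stated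
subgroup because `J_l u₀ = f^{(l)}`.

For the equivalences, let `C` be a commutative matrix algebra with `C v = ℝⁿ`. Then `M ↦ M v` is a
linear isomorphism `C ≃ ℝⁿ`, so density questions about `ℝⁿ` become questions inside `C`, where
`exp` is an open homomorphism from addition to multiplication. There a dense set has a locally dense
exponential image, and a locally dense multiplicative group has a dense group of logarithms.

(iii) ⇒ (ii): apply the first fact to the algebra generated by `g²`, since `exp` maps `g²` into `G`.
(i) ⇒ (iii): apply the second to the algebra generated by `G`. A locally dense orbit of `v` makes
`v` cyclic, so `v₀ = N v` with `N` in this algebra. `N` is invertible because no leading coordinate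
of `u₀` vanishes. It carries the dense set of vectors `2X v`, for `X` a logarithm of an element of
`G`, to vectors `2X v₀` with `2X ∈ g²`. -/

namespace AbelianLinear

open NormedSpace Topology Polynomial
open scoped Kronecker

/-! ### The exponential on nilpotent elements. -/

section NilpotentExp

variable {𝔸 : Type*} [NormedRing 𝔸] [NormedAlgebra ℝ 𝔸]

theorem exists_exp_eq_aeval_of_isNilpotent {N : 𝔸} (hN : IsNilpotent N) :
    ∃ q : ℝ[X], exp N = 1 + aeval N (X * (1 + X * q)) := by
  obtain ⟨k, hk⟩ := hN
  -- The exponential series stops before degree `k + 2`; `q` is what remains after splitting off `1`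
  -- and `X` and dividing by `X ^ 2`.
  refine ⟨∑ i ∈ Finset.range k, C (((i + 2).factorial : ℝ)⁻¹) * X ^ i, ?_⟩
  rw [exp_eq_tsum ℝ]
  change ∑' n : ℕ, ((n.factorial : ℝ)⁻¹) • N ^ n = _
  rw [tsum_eq_sum (s := Finset.range (k + 2))]
  · rw [Finset.sum_range_succ', Finset.sum_range_succ']
    simp only [map_mul, map_add, map_one, aeval_X, map_sum, aeval_C, map_pow]
    simp only [Algebra.algebraMap_eq_smul_one, smul_mul_assoc, one_mul, mul_add, mul_one,
      Finset.mul_sum, mul_smul_comm, ← pow_succ']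
    simp [add_comm, add_left_comm]
  · intro n hn
    have : k ≤ n := by simp at hn; omega
    rw [pow_eq_zero_of_le this hk, smul_zero]

theorem eq_zero_of_isNilpotent_of_exp_eq_one {N : 𝔸} (hN : IsNilpotent N) (h : exp N = 1) :
    N = 0 := by
  obtain ⟨q, hq⟩ := exists_exp_eq_aeval_of_isNilpotent hN
  rw [h, left_eq_add, map_mul, map_add, map_mul, map_one, aeval_X] at hq
  have hc : Commute N (aeval N q) := by
    have := Commute.all X q |>.map (aeval N)
    rwa [aeval_X] at this
  exact (hc.isNilpotent_mul_right hN).isUnit_one_add.mul_left_eq_zero.mp hq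

/-- `N` is a polynomial in `exp N - 1`: since `exp N - 1 = N (1 + N q(N))`, its powers agree with
those of `N` up to higher order, and nilpotency ends the recursion. -/
theorem commute_of_commute_exp_of_isNilpotent {N x : 𝔸} (hN : IsNilpotent N)
    (h : Commute x (exp N)) : Commute x N := by
  obtain ⟨q, hq⟩ := exists_exp_eq_aeval_of_isNilpotent hN
  obtain ⟨k, hk⟩ := hN
  have hw : Commute x (aeval N (X * (1 + X * q))) := by
    rw [← sub_eq_iff_eq_add'] at hq
    rw [← hq]
    exact h.sub_right (Commute.one_right x)
  -- Descending induction on the order `j` of vanishing at `0`, with `d` bounding the distance from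
  -- `j` up to `k`.
  have key : ∀ d j : ℕ, k ≤ j + d → ∀ p : ℝ[X], Commute x (aeval N (X ^ j * p)) := by
    intro d
    induction d with
    | zero =>
      intro j hj p
      rw [map_mul, map_pow, aeval_X, pow_eq_zero_of_le (by simpa using hj) hk, zero_mul]
      exact Commute.zero_right x
    | succ d ih =>
      intro j hj p
      have ih' := ih (j + 1) (by omega)
      have hpow : Commute x (aeval N (X ^ j : ℝ[X])) := by
        obtain ⟨r, hr⟩ : X ∣ (1 + X * q) ^ j - 1 := by
          have := sub_dvd_pow_sub_pow (1 + X * q) 1 j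
          rw [add_sub_cancel_left, one_pow] at this
          exact (dvd_mul_right X q).trans this
        have h1 : (X ^ j : ℝ[X]) = (X * (1 + X * q)) ^ j - X ^ (j + 1) * r := by
          rw [mul_pow, pow_succ, mul_assoc, ← hr]; ring
        rw [h1, map_sub, map_pow]
        exact (hw.pow_right j).sub_right (ih' r)
      have h2 : X ^ j * p = X ^ (j + 1) * p.divX + p.coeff 0 • X ^ j := by
        conv_lhs => rw [← p.divX_mul_X_add]
        rw [smul_eq_C_mul]; ring
      rw [h2, map_add, map_smul]
      exact (ih' _).add_right (hpow.smul_right _)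
  simpa using key k 1 (by omega) 1

variable [CompleteSpace 𝔸]

/-- `N` commutes with `exp N = exp N'`, hence with `N'`; so `N - N'` is nilpotent with exponential
`1`. -/
theorem eq_of_isNilpotent_of_exp_eq {N N' : 𝔸} (hN : IsNilpotent N) (hN' : IsNilpotent N')
    (h : exp N = exp N') : N = N' := by
  let _ : NormedAlgebra ℚ 𝔸 := NormedAlgebra.restrictScalars ℚ ℝ 𝔸
  have hc : Commute N N' :=
    commute_of_commute_exp_of_isNilpotent hN' (h ▸ (Commute.refl N).exp_right)
  refine sub_eq_zero.mp (eq_zero_of_isNilpotent_of_exp_eq_one (hc.isNilpotent_sub hN hN') ?_)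
  have h0 : exp (-N') * exp N' = 1 := by
    rw [← exp_add_of_commute (Commute.refl N').neg_left, neg_add_cancel, exp_zero]
  rw [sub_eq_neg_add, exp_add_of_commute hc.symm.neg_left, h, h0]

end NilpotentExp

/-! ### The exponential of a commutative Banach algebra: openness and density. -/

section CommutativeExp

variable {C : Type*} [NormedCommRing C] [NormedAlgebra ℝ C] [CompleteSpace C]

/-- The derivative at `x` is multiplication by the unit `exp x`, hence surjective. -/
theorem isOpenMap_exp : IsOpenMap (exp : C → C) := by
  let _ : NormedAlgebra ℚ C := NormedAlgebra.restrictScalars ℚ ℝ C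
  refine isOpenMap_iff_nhds_le.2 fun x => ?_
  refine (HasStrictFDerivAt.map_nhds_eq_of_surj (hasStrictFDerivAt_exp (𝕂 := ℝ) (x := x)) ?_).ge
  refine LinearMap.range_eq_top.2 fun y => ⟨exp (-x) * y, ?_⟩
  change exp x * (exp (-x) * y) = y
  rw [← mul_assoc, ← exp_add, add_neg_cancel, exp_zero, one_mul]

theorem closure_exp_image_mem_nhds_one {H : Set C} (hH : Dense H) :
    closure (exp '' H) ∈ 𝓝 (1 : C) := by
  let _ : NormedAlgebra ℚ C := NormedAlgebra.restrictScalars ℚ ℝ C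
  have h1 : Set.range (exp : C → C) ∈ 𝓝 (1 : C) :=
    isOpenMap_exp.isOpen_range.mem_nhds ⟨0, exp_zero⟩
  refine Filter.mem_of_superset h1 ?_
  rw [← Set.image_univ, ← hH.closure_eq]
  exact image_closure_subset_closure_image exp_continuous

/-- The logarithms of a locally dense multiplicative group form a dense additive group. -/
theorem dense_exp_preimage {S : Subgroup Cˣ}
    (hS : (interior (closure ((↑) '' (S : Set Cˣ) : Set C))).Nonempty) :
    Dense (exp ⁻¹' ((↑) '' (S : Set Cˣ) : Set C)) := by
  let _ : NormedAlgebra ℚ C := NormedAlgebra.restrictScalars ℚ ℝ C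
  set T : Set C := (↑) '' (S : Set Cˣ) with hT
  -- An interior point of the closure can be taken in `T` itself; translating by its inverse moves
  -- it to `1`.
  have h1 : closure T ∈ 𝓝 (1 : C) := by
    obtain ⟨_, hx, a, ha, rfl⟩ := mem_closure_iff.1
      (interior_subset hS.choose_spec) _ isOpen_interior hS.choose_spec
    have hcont : Continuous fun y : C => (a : C) * y := by fun_prop
    have hcont' : Continuous fun y : C => ((a⁻¹ : Cˣ) : C) * y := by fun_prop
    have h2 : (fun y : C => (a : C) * y) ⁻¹' closure T ∈ 𝓝 (1 : C) :=
      hcont.continuousAt (by simpa using mem_interior_iff_mem_nhds.1 hx)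
    refine Filter.mem_of_superset h2 fun y hy => ?_
    have h3 : ((a⁻¹ : Cˣ) : C) * (a * y) ∈ closure T := by
      refine closure_mono ?_ (image_closure_subset_closure_image hcont' ⟨_, hy, rfl⟩)
      rintro _ ⟨_, ⟨b, hb, rfl⟩, rfl⟩
      exact ⟨a⁻¹ * b, S.mul_mem (S.inv_mem ha) hb, by simp⟩
    simpa using h3
  let H : AddSubgroup C :=
    { carrier := exp ⁻¹' T
      zero_mem' := ⟨1, S.one_mem, by simp⟩
      add_mem' := by
        rintro x y ⟨a, ha, hx⟩ ⟨b, hb, hy⟩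
        exact ⟨a * b, S.mul_mem ha hb, by simp [exp_add, hx, hy]⟩
      neg_mem' := by
        rintro x ⟨a, ha, hx⟩
        refine ⟨a⁻¹, S.inv_mem ha, ?_⟩
        rw [Units.inv_eq_of_mul_eq_one_right]
        rw [hx, ← exp_add, add_neg_cancel, exp_zero] }
  -- As `exp` is open, `exp ⁻¹' closure T` lies in the closure of `exp ⁻¹' T`. The closure of `H` is
  -- then an open and closed subgroup of a connected space.
  have h4 : closure (H : Set C) ∈ 𝓝 (0 : C) := by
    refine Filter.mem_of_superset ?_ 
      (isOpenMap_exp.preimage_closure_subset_closure_preimage (s := T))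
    exact (exp_continuous (𝔸 := C)).continuousAt (by rwa [exp_zero])
  have h5 : IsOpen (H.topologicalClosure : Set C) := AddSubgroup.isOpen_of_mem_nhds _ h4
  have h6 : (H.topologicalClosure : Set C) = Set.univ :=
    IsClopen.eq_univ ⟨H.isClosed_topologicalClosure, h5⟩ ⟨0, zero_mem _⟩
  exact dense_iff_closure_eq.2 h6

end CommutativeExp

/-! ### Evaluation of a matrix algebra at a cyclic vector. -/

section CyclicVector

variable {n : ℕ}

/-- Evaluation of the matrices of a subalgebra at a vector. -/
def evalMap (C : Subalgebra ℝ (Matrix (Fin n) (Fin n) ℝ)) (v : Fin n → ℝ) :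
    C →ₗ[ℝ] (Fin n → ℝ) where
  toFun M := (M : Matrix (Fin n) (Fin n) ℝ) *ᵥ v
  map_add' M N := by simp [Matrix.add_mulVec]
  map_smul' a M := by simp [Matrix.smul_mulVec]

variable {C : Subalgebra ℝ (Matrix (Fin n) (Fin n) ℝ)} {v : Fin n → ℝ}

theorem evalMap_apply (M : C) : evalMap C v M = (M : Matrix (Fin n) (Fin n) ℝ) *ᵥ v := rfl

/-- If `M v = 0` and `e_i = N v`, then `M e_i = N M v = 0`. -/
theorem evalMap_injective (hC : ∀ x ∈ C, ∀ y ∈ C, x * y = y * x)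
    (hv : Function.Surjective (evalMap C v)) : Function.Injective (evalMap C v) := by
  rw [← LinearMap.ker_eq_bot, LinearMap.ker_eq_bot']
  rintro ⟨M, hM⟩ h
  rw [evalMap_apply] at h
  ext1
  change M = 0
  refine Matrix.ext_of_mulVec_single fun i => ?_
  obtain ⟨⟨N, hN⟩, hNi⟩ := hv (Pi.single i 1)
  rw [← hNi, evalMap_apply, Matrix.mulVec_mulVec, hC M hM N hN, ← Matrix.mulVec_mulVec]
  simp [h]

theorem evalMap_surjective_of_dense {E : Set (Fin n → ℝ)} (hE : Dense E)
    (h : ∀ x ∈ E, ∃ M ∈ C, M *ᵥ v = x) : Function.Surjective (evalMap C v) := by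
  rw [← LinearMap.range_eq_top, ← SetLike.coe_set_eq, Submodule.top_coe]
  refine Set.eq_univ_of_univ_subset ?_
  rw [← hE.closure_eq]
  refine closure_minimal ?_ (Submodule.closed_of_finiteDimensional _)
  intro x hx
  obtain ⟨M, hM, rfl⟩ := h x hx
  exact ⟨⟨M, hM⟩, rfl⟩

theorem evalMap_surjective_of_locallyDense {E : Set (Fin n → ℝ)} (hE : LocallyDense E)
    (h : ∀ x ∈ E, ∃ M ∈ C, M *ᵥ v = x) : Function.Surjective (evalMap C v) := by
  rw [← LinearMap.range_eq_top]
  refine Submodule.eq_top_of_nonempty_interior' _ (hE.mono (interior_mono ?_))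
  refine closure_minimal ?_ (Submodule.closed_of_finiteDimensional _)
  intro x hx
  obtain ⟨M, hM, rfl⟩ := h x hx
  exact ⟨⟨M, hM⟩, rfl⟩

end CyclicVector

/-! ### Transport of the density results through a linear isomorphism `C ≃ ℝⁿ`. -/

section NormedSubalgebra

variable {𝔸 : Type*} [NormedRing 𝔸] [NormedAlgebra ℝ 𝔸]

/-- The norm structure of a commutative subalgebra of a normed algebra. -/
abbrev normedCommRingOfComm (C : Subalgebra ℝ 𝔸) (hC : ∀ x ∈ C, ∀ y ∈ C, x * y = y * x) :
    NormedCommRing C :=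
  { (inferInstance : NormedRing C) with
    mul_comm := fun x y => Subtype.ext (hC x x.2 y y.2) }

theorem coe_exp_subalgebra (C : Subalgebra ℝ 𝔸) [FiniteDimensional ℝ C] (X : C) :
    ((exp X : C) : 𝔸) = exp (X : 𝔸) := by
  let _ : NormedAlgebra ℚ C := NormedAlgebra.restrictScalars ℚ ℝ C
  let _ : NormedAlgebra ℚ 𝔸 := NormedAlgebra.restrictScalars ℚ ℝ 𝔸
  have : CompleteSpace C := FiniteDimensional.complete ℝ C
  exact map_exp C.val continuous_subtype_val X

variable {n : ℕ} {C : Subalgebra ℝ 𝔸} [FiniteDimensional ℝ C] (φ : C ≃ₗ[ℝ] (Fin n → ℝ))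

theorem locallyDense_image_exp (hC : ∀ x ∈ C, ∀ y ∈ C, x * y = y * x) {H : Set C}
    (hd : Dense (φ '' H)) : LocallyDense (φ '' {M | ∃ X ∈ H, (M : 𝔸) = exp (X : 𝔸)}) := by
  let ψ : C ≃ₜ (Fin n → ℝ) := φ.toContinuousLinearEquiv.toHomeomorph
  have hψ : ∀ x, φ x = ψ x := fun _ => rfl
  simp only [hψ] at *
  have hH : Dense H := by
    have := hd.preimage ψ.isOpenMap
    rwa [ψ.preimage_image] at this
  let _ : NormedCommRing C := normedCommRingOfComm C hC
  have : CompleteSpace C := FiniteDimensional.complete ℝ C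
  have h2 := ψ.isOpenMap.image_mem_nhds (closure_exp_image_mem_nhds_one hH)
  rw [ψ.image_closure] at h2
  refine ⟨ψ 1, mem_interior_iff_mem_nhds.2 (Filter.mem_of_superset h2 (closure_mono ?_))⟩
  rintro _ ⟨_, ⟨X, hX, rfl⟩, rfl⟩
  exact ⟨_, ⟨X, hX, coe_exp_subalgebra C X⟩, rfl⟩

theorem dense_image_log (hC : ∀ x ∈ C, ∀ y ∈ C, x * y = y * x) (S : Subgroup Cˣ)
    (hd : LocallyDense (φ '' ((↑) '' (S : Set Cˣ)))) :
    Dense (φ '' {X | ∃ a ∈ S, exp (X : 𝔸) = ((a : C) : 𝔸)}) := by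
  let ψ : C ≃ₜ (Fin n → ℝ) := φ.toContinuousLinearEquiv.toHomeomorph
  have hψ : ∀ x, φ x = ψ x := fun _ => rfl
  simp only [hψ] at *
  have hS : (interior (closure ((↑) '' (S : Set Cˣ) : Set C))).Nonempty := by
    unfold LocallyDense at hd
    rw [← ψ.image_closure, ← ψ.image_interior] at hd
    exact hd.of_image
  let _ : NormedCommRing C := normedCommRingOfComm C hC
  have : CompleteSpace C := FiniteDimensional.complete ℝ C
  have h := ψ.surjective.denseRange.dense_image ψ.continuous (dense_exp_preimage hS)
  refine h.mono ?_
  rintro _ ⟨X, ⟨a, ha, hX⟩, rfl⟩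
  refine ⟨X, ⟨a, ha, ?_⟩, rfl⟩
  rw [hX]
  exact (coe_exp_subalgebra C X).symm

end NormedSubalgebra

/-! ### Density of logarithms and local density of orbits at a vector. -/

section CyclicVector

variable {n : ℕ} {C : Subalgebra ℝ (Matrix (Fin n) (Fin n) ℝ)} {v : Fin n → ℝ}

/-- Evaluation at a cyclic vector of a commutative algebra, as a linear equivalence. -/
noncomputable def evalEquiv (hC : ∀ x ∈ C, ∀ y ∈ C, x * y = y * x)
    (hv : Function.Surjective (evalMap C v)) : C ≃ₗ[ℝ] (Fin n → ℝ) :=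
  LinearEquiv.ofBijective (evalMap C v) ⟨evalMap_injective hC hv, hv⟩

theorem evalEquiv_apply (hC : ∀ x ∈ C, ∀ y ∈ C, x * y = y * x)
    (hv : Function.Surjective (evalMap C v)) (M : C) :
    evalEquiv hC hv M = (M : Matrix (Fin n) (Fin n) ℝ) *ᵥ v := rfl

theorem locallyDense_exp_of_dense (hC : ∀ x ∈ C, ∀ y ∈ C, x * y = y * x)
    {H : Set (Matrix (Fin n) (Fin n) ℝ)} (hH : H ⊆ C)
    (hd : Dense ((fun M => M *ᵥ v) '' H)) :
    LocallyDense ((fun M => exp M *ᵥ v) '' H) := by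
  have hv : Function.Surjective (evalMap C v) := by
    refine evalMap_surjective_of_dense hd ?_
    rintro _ ⟨M, hM, rfl⟩
    exact ⟨M, hH hM, rfl⟩
  let φ := evalEquiv hC hv
  let _ : NormedRing (Matrix (Fin n) (Fin n) ℝ) := Matrix.linftyOpNormedRing
  let _ : NormedAlgebra ℝ (Matrix (Fin n) (Fin n) ℝ) := Matrix.linftyOpNormedAlgebra
  have h := locallyDense_image_exp φ hC (H := {M | (M : Matrix (Fin n) (Fin n) ℝ) ∈ H})
    (hd.mono (by rintro _ ⟨M, hM, rfl⟩; exact ⟨⟨M, hH hM⟩, hM, rfl⟩))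
  refine h.mono (interior_mono (closure_mono ?_))
  rintro _ ⟨M, ⟨X, hX, hM⟩, rfl⟩
  refine ⟨X, hX, ?_⟩
  rw [evalEquiv_apply, hM]
  rfl

theorem dense_log_of_locallyDense_orbit (hC : ∀ x ∈ C, ∀ y ∈ C, x * y = y * x)
    {G : Subgroup (GL (Fin n) ℝ)} (hG : ∀ A ∈ G, (A : Matrix (Fin n) (Fin n) ℝ) ∈ C)
    (hd : LocallyDense (orbit G v)) :
    Dense ((fun M => M *ᵥ v) '' {M : Matrix (Fin n) (Fin n) ℝ |
      M ∈ C ∧ ∃ A ∈ G, exp M = (A : Matrix (Fin n) (Fin n) ℝ)}) := by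
  have hv : Function.Surjective (evalMap C v) := by
    refine evalMap_surjective_of_locallyDense hd ?_
    rintro _ ⟨A, hA, rfl⟩
    exact ⟨A, hG A hA, rfl⟩
  let φ := evalEquiv hC hv
  -- Inverses of elements of `G` also lie in `C`, so `G` consists of units of `C`.
  let S : Subgroup Cˣ := G.comap (Units.map (C.val : C →* Matrix (Fin n) (Fin n) ℝ))
  have himg : orbit G v ⊆ φ '' ((↑) '' (S : Set Cˣ) : Set C) := by
    rintro _ ⟨A, hA, rfl⟩
    refine ⟨⟨A, hG A hA⟩, ⟨⟨⟨A, hG A hA⟩, ⟨(A⁻¹ : GL (Fin n) ℝ), hG _ (G.inv_mem hA)⟩,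
      Subtype.ext A.mul_inv, Subtype.ext A.inv_mul⟩, ?_, rfl⟩, rfl⟩
    change Units.map _ _ ∈ G
    convert hA
    ext1
    rfl
  let _ : NormedRing (Matrix (Fin n) (Fin n) ℝ) := Matrix.linftyOpNormedRing
  let _ : NormedAlgebra ℝ (Matrix (Fin n) (Fin n) ℝ) := Matrix.linftyOpNormedAlgebra
  have h := dense_image_log φ hC S (hd.mono (interior_mono (closure_mono himg)))
  refine h.mono ?_
  rintro _ ⟨X, ⟨a, ha, hX⟩, rfl⟩
  exact ⟨X, ⟨X.2, _, ha, hX⟩, rfl⟩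

end CyclicVector

/-! ### The algebra `𝒦` as scalars plus a commuting nilpotent part. -/

section BlockAlgebra

section Filtration

variable {ι : Type*} (h : ι → ℕ)

/-- Matrices lowering the filtration given by `h` by at least `w` steps. -/
def IsLower (w : ℕ) (M : Matrix ι ι ℝ) : Prop :=
  ∀ x y, h x < h y + w → M x y = 0

variable {h}

theorem IsLower.mono {w w' : ℕ} (hw : w' ≤ w) {M : Matrix ι ι ℝ} (hM : IsLower h w M) :
    IsLower h w' M := fun x y hxy => hM x y (by omega)

theorem IsLower.add {w : ℕ} {M N : Matrix ι ι ℝ} (hM : IsLower h w M) (hN : IsLower h w N) :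
    IsLower h w (M + N) := fun x y hxy => by
  rw [Matrix.add_apply, hM x y hxy, hN x y hxy, add_zero]

theorem isLower_one [DecidableEq ι] : IsLower h 0 (1 : Matrix ι ι ℝ) := fun x y hxy =>
  Matrix.one_apply_ne (by rintro rfl; omega)

theorem IsLower.mul [Fintype ι] {w w' : ℕ} {M N : Matrix ι ι ℝ} (hM : IsLower h w M) (hN : IsLower h w' N) :
    IsLower h (w + w') (M * N) := by
  intro x y hxy
  rw [Matrix.mul_apply]
  refine Finset.sum_eq_zero fun z _ => ?_
  by_cases hxz : h x < h z + w
  · rw [hM x z hxz, zero_mul]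
  · rw [hN z y (by omega), mul_zero]

variable [Fintype ι] [DecidableEq ι]

theorem IsLower.pow {M : Matrix ι ι ℝ} (hM : IsLower h 1 M) (k : ℕ) : IsLower h k (M ^ k) := by
  induction k with
  | zero => simpa using isLower_one
  | succ k ih => rw [pow_succ]; exact ih.mul hM

theorem IsLower.isNilpotent {M : Matrix ι ι ℝ} (hM : IsLower h 1 M) : IsNilpotent M := by
  refine ⟨Finset.univ.sup h + 1, ?_⟩
  ext x y
  exact hM.pow _ x y (by have := Finset.le_sup (f := h) (Finset.mem_univ x); omega)

end Filtration

variable {n r s : ℕ} (η : Partition n r s)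

/-- The position of a coordinate inside its block, counted in steps of the block size. -/
def height : η.Index → ℕ
  | Sum.inl ⟨_, a⟩ => a
  | Sum.inr ⟨_, (j, _)⟩ => j

/-- The block diagonal matrices with scalar blocks, where complex scalars act on the `2 × 2`
blocks. -/
noncomputable def scalarHom :
    ((Fin r → ℝ) × (Fin s → ℂ)) →ₐ[ℝ] Matrix η.Index η.Index ℝ :=
  AlgHom.ofLinearMap
    { toFun := fun c => Matrix.fromBlocks
        (Matrix.blockDiagonal' fun k => c.1 k • (1 : Matrix (Fin (η.realSize k)) _ ℝ)) 0 0
        (Matrix.blockDiagonal' fun l =>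
          (1 : Matrix (Fin (η.cplxSize l)) _ ℝ) ⊗ₖ Algebra.leftMulMatrix Complex.basisOneI (c.2 l))
      map_add' := fun c d => by
        simp only [Prod.fst_add, Prod.snd_add, Pi.add_apply, add_smul, map_add,
          Matrix.kronecker_add, Matrix.fromBlocks_add, ← Matrix.blockDiagonal'_add, add_zero]
        rfl
      map_smul' := fun a c => by
        simp only [Prod.smul_fst, Prod.smul_snd, Pi.smul_apply, smul_assoc, map_smul,
          Matrix.kronecker_smul, Matrix.fromBlocks_smul, ← Matrix.blockDiagonal'_smul, smul_zero,
          RingHom.id_apply]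
        rfl }
    (by
      simp only [LinearMap.coe_mk, AddHom.coe_mk, Prod.fst_one, Prod.snd_one, Pi.one_apply,
        one_smul, map_one, Matrix.one_kronecker_one]
      rw [← Matrix.fromBlocks_one, ← Matrix.blockDiagonal'_one, ← Matrix.blockDiagonal'_one]
      rfl)
    (fun c d => by
      simp only [LinearMap.coe_mk, AddHom.coe_mk, Prod.fst_mul, Prod.snd_mul, Pi.mul_apply,
        map_mul, Matrix.fromBlocks_multiply, ← Matrix.blockDiagonal'_mul,
        ← Matrix.mul_kronecker_mul, Matrix.mul_one, Matrix.smul_mul, Matrix.one_mul, smul_smul,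
        Matrix.mul_zero, Matrix.zero_mul, add_zero, zero_add])

theorem scalarHom_apply (c : (Fin r → ℝ) × (Fin s → ℂ)) :
    scalarHom η c = Matrix.fromBlocks
      (Matrix.blockDiagonal' fun k => c.1 k • (1 : Matrix (Fin (η.realSize k)) _ ℝ)) 0 0
      (Matrix.blockDiagonal' fun l =>
        (1 : Matrix (Fin (η.cplxSize l)) _ ℝ) ⊗ₖ
          !![(c.2 l).re, -(c.2 l).im; (c.2 l).im, (c.2 l).re]) := by
  simp only [← Algebra.leftMulMatrix_complex]
  rfl

theorem scalarHom_mulVec_inl (c : (Fin r → ℝ) × (Fin s → ℂ)) (v : η.Index → ℝ) (k : Fin r)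
    (a : Fin (η.realSize k)) :
    (scalarHom η c *ᵥ v) (Sum.inl ⟨k, a⟩) = c.1 k * v (Sum.inl ⟨k, a⟩) := by
  rw [scalarHom_apply, Matrix.mulVec, dotProduct, Fintype.sum_sum_type, Fintype.sum_sigma,
    Finset.sum_eq_single k]
  · simp [Matrix.one_apply]
  · intro k' _ hk
    simp [Matrix.blockDiagonal'_apply_ne _ _ _ hk.symm]
  · simp

theorem scalarHom_vecMul_inl (c : (Fin r → ℝ) × (Fin s → ℂ)) (v : η.Index → ℝ) (k : Fin r)
    (a : Fin (η.realSize k)) :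
    (v ᵥ* scalarHom η c) (Sum.inl ⟨k, a⟩) = v (Sum.inl ⟨k, a⟩) * c.1 k := by
  rw [scalarHom_apply, Matrix.vecMul, dotProduct, Fintype.sum_sum_type, Fintype.sum_sigma,
    Finset.sum_eq_single k]
  · simp [Matrix.one_apply]
  · intro k' _ hk
    simp [Matrix.blockDiagonal'_apply_ne _ _ _ hk]
  · simp

theorem scalarHom_mulVec_inr (c : (Fin r → ℝ) × (Fin s → ℂ)) (v : η.Index → ℝ) (l : Fin s)
    (j : Fin (η.cplxSize l)) (i : Fin 2) :
    (scalarHom η c *ᵥ v) (Sum.inr ⟨l, j, i⟩) =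
      ∑ i', !![(c.2 l).re, -(c.2 l).im; (c.2 l).im, (c.2 l).re] i i' * v (Sum.inr ⟨l, j, i'⟩) := by
  rw [scalarHom_apply, Matrix.mulVec, dotProduct, Fintype.sum_sum_type, Fintype.sum_sigma,
    Fintype.sum_sigma, Finset.sum_eq_single (s := Finset.univ (α := Fin s)) l]
  · rw [Fintype.sum_prod_type, Finset.sum_eq_single j]
    · simp
    · intro j' _ hj
      simp [Matrix.one_apply_ne hj.symm]
    · simp
  · intro l' _ hl
    simp [Matrix.blockDiagonal'_apply_ne _ _ _ hl.symm]
  · simp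

theorem scalarHom_vecMul_inr (c : (Fin r → ℝ) × (Fin s → ℂ)) (v : η.Index → ℝ) (l : Fin s)
    (j : Fin (η.cplxSize l)) (i : Fin 2) :
    (v ᵥ* scalarHom η c) (Sum.inr ⟨l, j, i⟩) =
      ∑ i', v (Sum.inr ⟨l, j, i'⟩) * !![(c.2 l).re, -(c.2 l).im; (c.2 l).im, (c.2 l).re] i' i := by
  rw [scalarHom_apply, Matrix.vecMul, dotProduct, Fintype.sum_sum_type, Fintype.sum_sigma,
    Fintype.sum_sigma, Finset.sum_eq_single (s := Finset.univ (α := Fin s)) l]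
  · rw [Fintype.sum_prod_type, Finset.sum_eq_single j]
    · simp
    · intro j' _ hj
      simp [Matrix.one_apply_ne hj]
    · simp
  · intro l' _ hl
    simp [Matrix.blockDiagonal'_apply_ne _ _ _ hl]
  · simp

theorem scalarHom_mulVec_inr_zero (c : (Fin r → ℝ) × (Fin s → ℂ)) (v : η.Index → ℝ) (l : Fin s)
    (j : Fin (η.cplxSize l)) :
    (scalarHom η c *ᵥ v) (Sum.inr ⟨l, j, 0⟩) =
      (c.2 l).re * v (Sum.inr ⟨l, j, 0⟩) - (c.2 l).im * v (Sum.inr ⟨l, j, 1⟩) := by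
  simp [scalarHom_mulVec_inr, sub_eq_add_neg]

theorem isLower_scalarHom (c : (Fin r → ℝ) × (Fin s → ℂ)) :
    IsLower (height η) 0 (scalarHom η c) := by
  rw [scalarHom_apply]
  rintro (⟨k, a⟩ | ⟨l, j, i⟩) (⟨k', a'⟩ | ⟨l', j', i'⟩) hxy
  · by_cases hk : k = k'
    · subst hk
      have : a ≠ a' := by rintro rfl; simp [height] at hxy
      simp [Matrix.one_apply_ne this]
    · simp [Matrix.blockDiagonal'_apply_ne _ _ _ hk]
  · simp
  · simp
  · by_cases hl : l = l'
    · subst hl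
      have : j ≠ j' := by rintro rfl; simp [height] at hxy
      simp [Matrix.one_apply_ne this]
    · simp [Matrix.blockDiagonal'_apply_ne _ _ _ hl]

/-- Strictly lower matrices commuting with all scalar blocks. -/
def IsNilPart (N : Matrix η.Index η.Index ℝ) : Prop :=
  IsLower (height η) 1 N ∧ ∀ c, Commute (scalarHom η c) N

variable {η}

theorem IsNilPart.isNilpotent {N : Matrix η.Index η.Index ℝ} (hN : IsNilPart η N) :
    IsNilpotent N := hN.1.isNilpotent

theorem isNilPart_zero : IsNilPart η 0 := ⟨fun _ _ _ => rfl, fun _ => Commute.zero_right _⟩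

theorem IsNilPart.add {M N : Matrix η.Index η.Index ℝ} (hM : IsNilPart η M)
    (hN : IsNilPart η N) : IsNilPart η (M + N) :=
  ⟨hM.1.add hN.1, fun c => (hM.2 c).add_right (hN.2 c)⟩

theorem IsNilPart.mul {M N : Matrix η.Index η.Index ℝ} (hM : IsNilPart η M)
    (hN : IsNilPart η N) : IsNilPart η (M * N) :=
  ⟨(hM.1.mul hN.1).mono (by omega), fun c => (hM.2 c).mul_right (hN.2 c)⟩

theorem IsNilPart.scalarHom_mul {N : Matrix η.Index η.Index ℝ} (hN : IsNilPart η N)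
    (c : (Fin r → ℝ) × (Fin s → ℂ)) : IsNilPart η (scalarHom η c * N) :=
  ⟨((isLower_scalarHom η c).mul hN.1).mono (by omega), fun d =>
    Commute.mul_right ((Commute.all d c).map (scalarHom η)) (hN.2 d)⟩

variable (η) in
/-- The algebra of sums of a scalar block matrix and a nilpotent part. -/
noncomputable def blockAlgebra : Subalgebra ℝ (Matrix η.Index η.Index ℝ) where
  carrier := {M | ∃ c N, IsNilPart η N ∧ M = scalarHom η c + N}
  mul_mem' := by
    rintro _ _ ⟨c, N, hN, rfl⟩ ⟨d, M, hM, rfl⟩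
    refine ⟨c * d, scalarHom η c * M + scalarHom η d * N + N * M,
      ((hM.scalarHom_mul c).add (hN.scalarHom_mul d)).add (hN.mul hM), ?_⟩
    rw [map_mul, add_mul, mul_add, mul_add, (hN.2 d).eq]
    abel
  add_mem' := by
    rintro _ _ ⟨c, N, hN, rfl⟩ ⟨d, M, hM, rfl⟩
    exact ⟨c + d, N + M, hN.add hM, by rw [map_add]; abel⟩
  algebraMap_mem' a := ⟨algebraMap ℝ _ a, 0, isNilPart_zero, by rw [AlgHom.commutes, add_zero]⟩

theorem scalarHom_mem_blockAlgebra (c : (Fin r → ℝ) × (Fin s → ℂ)) :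
    scalarHom η c ∈ blockAlgebra η := ⟨c, 0, isNilPart_zero, by rw [add_zero]⟩

theorem commute_scalarHom_of_mem_blockAlgebra {M : Matrix η.Index η.Index ℝ}
    (hM : M ∈ blockAlgebra η) (c : (Fin r → ℝ) × (Fin s → ℂ)) : Commute (scalarHom η c) M := by
  obtain ⟨d, N, hN, rfl⟩ := hM
  exact ((Commute.all c d).map (scalarHom η)).add_right (hN.2 c)

/-- The first coordinate of a real block. -/
def realFirst (k : Fin r) : η.Index := Sum.inl ⟨k, ⟨0, η.realSize_pos k⟩⟩

/-- The first two coordinates of a complex block. -/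
def cplxFirst (l : Fin s) (i : Fin 2) : η.Index := Sum.inr ⟨l, ⟨0, η.cplxSize_pos l⟩, i⟩

/-- A nilpotent part has no entries on or above the block diagonal, so the scalars can be read off
there. -/
theorem eq_of_scalarHom_add_eq {c d : (Fin r → ℝ) × (Fin s → ℂ)}
    {M N : Matrix η.Index η.Index ℝ} (hM : IsNilPart η M) (hN : IsNilPart η N)
    (h : scalarHom η c + M = scalarHom η d + N) : c = d := by
  have key : ∀ x y, height η x < height η y + 1 → scalarHom η c x y = scalarHom η d x y := by
    intro x y hxy
    have := congrFun (congrFun h x) y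
    rwa [Matrix.add_apply, Matrix.add_apply, hM.1 x y hxy, hN.1 x y hxy, add_zero, add_zero] at this
  rw [scalarHom_apply, scalarHom_apply] at key
  refine Prod.ext (funext fun k => ?_) (funext fun l => Complex.ext ?_ ?_)
  · simpa [realFirst] using key (realFirst k) (realFirst k) (by omega)
  · simpa [cplxFirst] using key (cplxFirst l 0) (cplxFirst l 0) (by omega)
  · simpa [cplxFirst] using key (cplxFirst l 1) (cplxFirst l 0) (by simp [cplxFirst, height])

theorem IsNilPart.mulVec_eq_zero {N : Matrix η.Index η.Index ℝ} (hN : IsNilPart η N)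
    (v : η.Index → ℝ) {x : η.Index} (hx : height η x = 0) : (N *ᵥ v) x = 0 := by
  rw [Matrix.mulVec, dotProduct]
  refine Finset.sum_eq_zero fun y _ => ?_
  rw [hN.1 x y (by omega), zero_mul]

/-- The height-zero coordinates of `M v` involve only the scalar part of `M`; their being nonzero
makes that scalar a unit, and a commuting nilpotent summand preserves this. -/
theorem isUnit_of_mem_blockAlgebra {M : Matrix η.Index η.Index ℝ} (hM : M ∈ blockAlgebra η)
    {v u : η.Index → ℝ} (h : M *ᵥ v = u) (hr : ∀ k, u (realFirst k) ≠ 0)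
    (hs : ∀ l, u (cplxFirst l 0) ≠ 0) : IsUnit M := by
  obtain ⟨c, N, hN, rfl⟩ := hM
  rw [Matrix.add_mulVec] at h
  have hc : IsUnit c := by
    rw [Prod.isUnit_iff, Pi.isUnit_iff, Pi.isUnit_iff]
    refine ⟨fun k => isUnit_iff_ne_zero.2 fun h0 => hr k ?_,
      fun l => isUnit_iff_ne_zero.2 fun h0 => hs l ?_⟩
    · rw [← h, Pi.add_apply, realFirst, scalarHom_mulVec_inl, h0, zero_mul,
         hN.mulVec_eq_zero v rfl, add_zero]
    · rw [← h, Pi.add_apply, cplxFirst, scalarHom_mulVec_inr_zero, h0, Complex.zero_re,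
        Complex.zero_im, zero_mul, zero_mul, sub_zero, hN.mulVec_eq_zero v rfl, add_zero]
  exact hN.isNilpotent.isUnit_add_left_of_commute (hc.map (scalarHom η)) (hN.2 c).symm

end BlockAlgebra

/-! ### Identification with `𝒦`, and the exponential on it. -/

section Exponential

variable {n r s : ℕ} {η : Partition n r s}

/-- Reduces commutation to columns and rows of `M`, where the coordinate formulas for `scalarHom`
apply. -/
theorem commute_scalarHom_iff {c : (Fin r → ℝ) × (Fin s → ℂ)} {M : Matrix η.Index η.Index ℝ} :
    Commute (scalarHom η c) M ↔
      ∀ x y, (scalarHom η c *ᵥ fun z => M z y) x = ((fun z => M x z) ᵥ* scalarHom η c) y :=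
  ⟨fun h x y => congrFun (congrFun h.eq x) y, fun h => Matrix.ext h⟩

theorem mem_blockAlgebra_iff {M : Matrix η.Index η.Index ℝ} :
    M ∈ blockAlgebra η ↔
      ∃ (T : ∀ k, Matrix (Fin (η.realSize k)) (Fin (η.realSize k)) ℝ)
        (D : ∀ l, Matrix (Fin (η.cplxSize l) × Fin 2) (Fin (η.cplxSize l) × Fin 2) ℝ),
        (∀ k, T k ∈ TSet (η.realSize k)) ∧ (∀ l, D l ∈ BSet (η.cplxSize l)) ∧
        M = Matrix.fromBlocks (Matrix.blockDiagonal' T) 0 0 (Matrix.blockDiagonal' D) := by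
  constructor
  · intro hM
    have hcomm := fun c => commute_scalarHom_iff.1 (commute_scalarHom_of_mem_blockAlgebra hM c)
    obtain ⟨c, N, hN, rfl⟩ := hM
    have hlow : IsLower (height η) 0 (scalarHom η c + N) :=
      (isLower_scalarHom η c).add (hN.1.mono (by omega))
    set M := scalarHom η c + N with hMdef
    have hMle : ∀ x y, height η x < height η y + 1 → M x y = scalarHom η c x y := fun x y hxy => by
      rw [hMdef, Matrix.add_apply, hN.1 x y hxy, add_zero]
    refine ⟨fun k => .of fun a b => M (Sum.inl ⟨k, a⟩) (Sum.inl ⟨k, b⟩),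
      fun l => .of fun a b => M (Sum.inr ⟨l, a⟩) (Sum.inr ⟨l, b⟩), fun k => ⟨?_, c.1 k, ?_⟩,
      fun l => ⟨fun i j => .of fun a b => M (Sum.inr ⟨l, i, a⟩) (Sum.inr ⟨l, j, b⟩), ?_, ?_, ?_,
        !![(c.2 l).re, -(c.2 l).im; (c.2 l).im, (c.2 l).re], ?_⟩, ?_⟩
    · intro a b hab
      exact hlow _ _ (by simpa [height] using hab)
    · intro a
      refine (hMle (Sum.inl ⟨k, a⟩) (Sum.inl ⟨k, a⟩) (by omega)).trans ?_
      simp [scalarHom_apply]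
    · exact fun _ _ _ _ => rfl
    · intro i j
      -- A `2 × 2` block lies in `𝕊` because it commutes with multiplication by `i`.
      have h0 := hcomm (0, fun _ => Complex.I) (Sum.inr ⟨l, i, 0⟩) (Sum.inr ⟨l, j, 0⟩)
      have h1 := hcomm (0, fun _ => Complex.I) (Sum.inr ⟨l, i, 0⟩) (Sum.inr ⟨l, j, 1⟩)
      simp [scalarHom_mulVec_inr, scalarHom_vecMul_inr] at h0 h1
      refine ⟨M (Sum.inr ⟨l, i, 0⟩) (Sum.inr ⟨l, j, 0⟩), M (Sum.inr ⟨l, i, 0⟩) (Sum.inr ⟨l, j, 1⟩),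
        ?_⟩
      ext a b
      fin_cases a <;> fin_cases b <;> simp <;> linarith
    · intro i j hij
      ext a b
      exact hlow _ _ (by simpa [height] using hij)
    · intro i
      ext a b
      refine (hMle (Sum.inr ⟨l, i, a⟩) (Sum.inr ⟨l, i, b⟩) (by simp [height])).trans ?_
      simp [scalarHom_apply]
    -- A scalar with pairwise distinct values on the `r + s` blocks: commuting with it kills all
    -- entries between different blocks.
    · let e : (Fin r → ℝ) × (Fin s → ℂ) := (fun k => (k : ℝ), fun l => ((r + l : ℕ) : ℂ))
      have he := hcomm e
      ext x y
      obtain (⟨k, a⟩ | ⟨l, j, i⟩) := x <;> obtain (⟨k', a'⟩ | ⟨l', j', i'⟩) := y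
      · by_cases hk : k = k'
        · subst hk
          simp
        · have h := he (Sum.inl ⟨k, a⟩) (Sum.inl ⟨k', a'⟩)
          rw [scalarHom_mulVec_inl, scalarHom_vecMul_inl, mul_comm] at h
          have hne : ((k : ℕ) : ℝ) ≠ (k' : ℕ) := by
            rw [Ne, Nat.cast_inj, Fin.val_inj]; exact hk
          simpa [Matrix.blockDiagonal'_apply_ne _ _ _ hk, e, hne] using h
      · have h := he (Sum.inl ⟨k, a⟩) (Sum.inr ⟨l', j', i'⟩)
        have hne : ((k : ℕ) : ℝ) ≠ ((r + l' : ℕ) : ℝ) := by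
          rw [Ne, Nat.cast_inj]; omega
        rw [scalarHom_mulVec_inl, scalarHom_vecMul_inr, mul_comm] at h
        fin_cases i' <;> simpa [e, -Nat.cast_add, hne] using h
      · have h := he (Sum.inr ⟨l, j, i⟩) (Sum.inl ⟨k', a'⟩)
        have hne : ((k' : ℕ) : ℝ) ≠ ((r + l : ℕ) : ℝ) := by
          rw [Ne, Nat.cast_inj]; omega
        rw [scalarHom_mulVec_inr, scalarHom_vecMul_inl, mul_comm] at h
        fin_cases i <;> simpa [e, -Nat.cast_add, hne, mul_comm _ (((r + l : ℕ) : ℝ)), hne.symm] using h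
      · by_cases hl : l = l'
        · subst hl
          simp
        · have h := he (Sum.inr ⟨l, j, i⟩) (Sum.inr ⟨l', j', i'⟩)
          have hne : ((r + l : ℕ) : ℝ) ≠ ((r + l' : ℕ) : ℝ) := by
            rw [Ne, Nat.cast_inj]; omega
          rw [scalarHom_mulVec_inr, scalarHom_vecMul_inr] at h
          fin_cases i <;> fin_cases i' <;>
            simpa [e, -Nat.cast_add, Matrix.blockDiagonal'_apply_ne _ _ _ hl, hne,
              mul_comm _ (((r + l' : ℕ) : ℝ))] using h
  · rintro ⟨T, D, hT, hD, rfl⟩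
    choose hTlow μ hμ using hT
    choose D' hDD' hS hDlow C hC using hD
    have hCS : ∀ l, C l ∈ SSet := fun l => hC l ⟨0, η.cplxSize_pos l⟩ ▸ hS l _ _
    choose α β hαβ using hCS
    set M : Matrix η.Index η.Index ℝ :=
      Matrix.fromBlocks (Matrix.blockDiagonal' T) 0 0 (Matrix.blockDiagonal' D) with hM
    -- Multiplication by `x + iy` has matrix `[[x, -y], [y, x]]`, so `[[α, β], [-β, α]]` is the
    -- scalar `α - iβ`.
    let c : (Fin r → ℝ) × (Fin s → ℂ) := (μ, fun l => ⟨α l, -β l⟩)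
    refine ⟨c, M - scalarHom η c, ⟨?_, fun d => Commute.sub_right ?_
      ((Commute.all d c).map (scalarHom η))⟩, by abel⟩
    · intro x y hxy
      rw [Matrix.sub_apply, hM, scalarHom_apply]
      obtain (⟨k, a⟩ | ⟨l, j, i⟩) := x <;> obtain (⟨k', a'⟩ | ⟨l', j', i'⟩) := y
      · by_cases hk : k = k'
        · subst hk
          simp only [height, Nat.lt_succ_iff] at hxy
          obtain h | h := (Fin.le_def.2 hxy).lt_or_eq
          · simp [hTlow k a a' h, Matrix.one_apply_ne h.ne]
          · subst h
            simp [hμ, c]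
        · simp [Matrix.blockDiagonal'_apply_ne _ _ _ hk]
      · simp
      · simp
      · by_cases hl : l = l'
        · subst hl
          simp only [height, Nat.lt_succ_iff] at hxy
          obtain h | h := (Fin.le_def.2 hxy).lt_or_eq
          · simp [hDD', hDlow l j j' h, Matrix.one_apply_ne h.ne]
          · subst h
            simp [hDD', hC, c, hαβ]
        · simp [Matrix.blockDiagonal'_apply_ne _ _ _ hl]
    · rw [commute_scalarHom_iff, hM]
      rintro (⟨k, a⟩ | ⟨l, j, i⟩) (⟨k', a'⟩ | ⟨l', j', i'⟩)
      · rw [scalarHom_mulVec_inl, scalarHom_vecMul_inl]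
        by_cases hk : k = k'
        · subst hk
          rw [mul_comm]
        · simp [Matrix.blockDiagonal'_apply_ne _ _ _ hk]
      · simp [scalarHom_mulVec_inl, scalarHom_vecMul_inr]
      · simp [scalarHom_mulVec_inr, scalarHom_vecMul_inl]
      · rw [scalarHom_mulVec_inr, scalarHom_vecMul_inr]
        by_cases hl : l = l'
        · subst hl
          obtain ⟨a, b, hab⟩ := hS l j j'
          fin_cases i <;> fin_cases i' <;> simp [hDD', hab] <;> ring
        · simp [Matrix.blockDiagonal'_apply_ne _ _ _ hl]

theorem IsLower.aeval {ι : Type*} [Fintype ι] [DecidableEq ι] {h : ι → ℕ} {N : Matrix ι ι ℝ}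
    (hN : IsLower h 1 N) (p : ℝ[X]) : IsLower h 0 (aeval N p) := by
  induction p using Polynomial.induction_on' with
  | add p q hp hq => rw [map_add]; exact hp.add hq
  | monomial k a =>
    rw [aeval_monomial, ← Algebra.smul_def]
    intro x y hxy
    rw [Matrix.smul_apply, (hN.pow k).mono (Nat.zero_le k) x y hxy, smul_zero]

theorem IsNilPart.exp_eq {N : Matrix η.Index η.Index ℝ} (hN : IsNilPart η N) :
    ∃ N', IsNilPart η N' ∧ exp N = 1 + N' := by
  let _ : NormedRing (Matrix η.Index η.Index ℝ) := Matrix.linftyOpNormedRing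
  let _ : NormedAlgebra ℝ (Matrix η.Index η.Index ℝ) := Matrix.linftyOpNormedAlgebra
  obtain ⟨q, hq⟩ := exists_exp_eq_aeval_of_isNilpotent hN.isNilpotent
  refine ⟨aeval N (X * (1 + X * q)), ⟨?_, fun c => ?_⟩, hq⟩
  · rw [map_mul, aeval_X]
    exact hN.1.mul (hN.1.aeval _)
  · induction (X * (1 + X * q) : ℝ[X]) using Polynomial.induction_on' with
    | add p q hp hq => rw [map_add]; exact hp.add_right hq
    | monomial k a =>
      rw [aeval_monomial, ← Algebra.smul_def]
      exact ((hN.2 c).pow_right k).smul_right a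

theorem exp_scalarHom (c : (Fin r → ℝ) × (Fin s → ℂ)) :
    exp (scalarHom η c) =
      scalarHom η (fun k => Real.exp (c.1 k), fun l => Complex.exp (c.2 l)) := by
  have hc : (exp c : (Fin r → ℝ) × (Fin s → ℂ)) =
      (fun k => Real.exp (c.1 k), fun l => Complex.exp (c.2 l)) := by
    refine Prod.ext ?_ ?_
    · rw [Prod.fst_exp, Pi.exp_def, Real.exp_eq_exp_ℝ]
    · rw [Prod.snd_exp, Pi.exp_def, Complex.exp_eq_exp_ℂ]
  let _ : NormedRing (Matrix η.Index η.Index ℝ) := Matrix.linftyOpNormedRing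
  let _ : NormedAlgebra ℝ (Matrix η.Index η.Index ℝ) := Matrix.linftyOpNormedAlgebra
  rw [← hc]
  exact (map_exp (scalarHom η)
    (LinearMap.continuous_of_finiteDimensional (scalarHom η).toLinearMap) c).symm

theorem exp_scalarHom_add (c : (Fin r → ℝ) × (Fin s → ℂ)) {N : Matrix η.Index η.Index ℝ}
    (hN : IsNilPart η N) : exp (scalarHom η c + N) =
      scalarHom η (fun k => Real.exp (c.1 k), fun l => Complex.exp (c.2 l)) * exp N := by
  rw [Matrix.exp_add_of_commute _ _ (hN.2 c), exp_scalarHom]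

theorem isUnit_expScalar (c : (Fin r → ℝ) × (Fin s → ℂ)) :
    IsUnit ((fun k => Real.exp (c.1 k), fun l => Complex.exp (c.2 l)) :
      (Fin r → ℝ) × (Fin s → ℂ)) := by
  rw [Prod.isUnit_iff, Pi.isUnit_iff, Pi.isUnit_iff]
  exact ⟨fun k => isUnit_iff_ne_zero.2 (Real.exp_ne_zero _),
    fun l => isUnit_iff_ne_zero.2 (Complex.exp_ne_zero _)⟩

/-- The scalar factors of both exponentials are units commuting with everything in sight, so they
cancel; what is left is the nilpotent case, used once for each factor. -/
theorem commute_of_commute_exp {X Y : Matrix η.Index η.Index ℝ} (hX : X ∈ blockAlgebra η)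
    (hY : Y ∈ blockAlgebra η) (h : Commute (exp X) (exp Y)) : Commute X Y := by
  obtain ⟨c, N, hN, rfl⟩ := hX
  obtain ⟨d, M, hM, rfl⟩ := hY
  have hcomm : ∀ (e) {K : Matrix η.Index η.Index ℝ}, IsNilPart η K →
      Commute (scalarHom η e) (exp K) := fun e K hK => (hK.2 e).exp_right
  rw [exp_scalarHom_add c hN, exp_scalarHom_add d hM] at h
  set c' := ((fun k => Real.exp (c.1 k), fun l => Complex.exp (c.2 l)) :
    (Fin r → ℝ) × (Fin s → ℂ)) with hc'
  set d' := ((fun k => Real.exp (d.1 k), fun l => Complex.exp (d.2 l)) :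
    (Fin r → ℝ) × (Fin s → ℂ)) with hd'
  have hu : IsUnit (scalarHom η (c' * d')) :=
    ((isUnit_expScalar c).mul (isUnit_expScalar d)).map (scalarHom η)
  have h1 : Commute (exp N) (exp M) := by
    refine hu.mul_left_cancel ?_
    have h2 := h.eq
    rw [(hcomm d' hN).symm.mul_mul_mul_comm, (hcomm c' hM).symm.mul_mul_mul_comm,
      ← map_mul, ← map_mul, mul_comm d' c'] at h2
    exact h2
  have h3 : Commute N M := by
    let _ : NormedRing (Matrix η.Index η.Index ℝ) := Matrix.linftyOpNormedRing
    let _ : NormedAlgebra ℝ (Matrix η.Index η.Index ℝ) := Matrix.linftyOpNormedAlgebra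
    exact (commute_of_commute_exp_of_isNilpotent hN.isNilpotent
      (commute_of_commute_exp_of_isNilpotent hM.isNilpotent h1).symm).symm
  exact (((Commute.all c d).map (scalarHom η)).add_right (hM.2 c)).add_left
    ((hN.2 d).symm.add_right h3)

/-- The complex structure of the `l`-th complex block. -/
noncomputable def cplxUnit (η : Partition n r s) (l : Fin s) : Matrix η.Index η.Index ℝ :=
  scalarHom η (0, Pi.single l Complex.I)

theorem sum_cplxUnit (t : Fin s → ℝ) :
    ∑ l, t l • cplxUnit η l = scalarHom η (0, fun l => t l * Complex.I) := by
  simp only [cplxUnit, ← map_smul, ← map_sum]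
  congr 1
  refine Prod.ext ?_ ?_
  · simp [Prod.fst_sum]
  · ext l
    simp [Prod.snd_sum, Finset.sum_apply, Pi.single_apply]

theorem exp_sum_two_pi_cplxUnit (t : Fin s → ℤ) :
    exp (∑ l, (2 * Real.pi * (t l : ℝ)) • cplxUnit η l) = 1 := by
  rw [sum_cplxUnit, exp_scalarHom, ← map_one (scalarHom η)]
  congr 1
  refine Prod.ext ?_ ?_
  · ext; simp
  · ext l
    have h : (((2 * Real.pi * (t l : ℝ) : ℝ) : ℂ) * Complex.I) =
        (t l : ℂ) * (2 * Real.pi * Complex.I) := by push_cast; ring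
    simp only [h, Complex.exp_int_mul_two_pi_mul_I]
    rfl

/-- Scalar parts can be compared first: the real exponential is injective and the complex one has
periods `2πi`. After cancelling them, the nilpotent parts coincide. -/
theorem exists_eq_add_of_exp_eq {X Y : Matrix η.Index η.Index ℝ} (hX : X ∈ blockAlgebra η)
    (hY : Y ∈ blockAlgebra η) (h : exp X = exp Y) :
    ∃ t : Fin s → ℤ, X = Y + ∑ l, (2 * Real.pi * (t l : ℝ)) • cplxUnit η l := by
  obtain ⟨c, N, hN, rfl⟩ := hX
  obtain ⟨d, M, hM, rfl⟩ := hY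
  rw [exp_scalarHom_add c hN, exp_scalarHom_add d hM] at h
  obtain ⟨N', hN', hNe⟩ := hN.exp_eq
  obtain ⟨M', hM', hMe⟩ := hM.exp_eq
  have hcd := h
  rw [hNe, hMe, mul_add, mul_add, mul_one, mul_one] at hcd
  replace hcd := eq_of_scalarHom_add_eq (hN'.scalarHom_mul _) (hM'.scalarHom_mul _) hcd
  rw [← hcd] at h
  have hNM : exp N = exp M := ((isUnit_expScalar c).map (scalarHom η)).mul_left_cancel h
  have hNM' : N = M := by
    let _ : NormedRing (Matrix η.Index η.Index ℝ) := Matrix.linftyOpNormedRing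
    let _ : NormedAlgebra ℝ (Matrix η.Index η.Index ℝ) := Matrix.linftyOpNormedAlgebra
    exact eq_of_isNilpotent_of_exp_eq hN.isNilpotent hM.isNilpotent hNM
  have h2 : ∀ l, ∃ t : ℤ, c.2 l = d.2 l + t * (2 * Real.pi * Complex.I) := fun l =>
    Complex.exp_eq_exp_iff_exists_int.1 (congrFun (congrArg Prod.snd hcd) l)
  choose t ht using h2
  refine ⟨t, ?_⟩
  have hc : c = d + (0, fun l => ((2 * Real.pi * (t l : ℝ) : ℝ) : ℂ) * Complex.I) := by
    refine Prod.ext ?_ ?_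
    · ext k
      have := congrFun (congrArg Prod.fst hcd) k
      simpa using this
    · ext l
      rw [ht l]
      simp only [Prod.snd_add, Pi.add_apply]
      push_cast
      ring
  rw [sum_cplxUnit, hNM', add_right_comm, ← map_add, ← hc]

end Exponential

/-! ### Transport to `P 𝒦 P⁻¹` and the periods of `exp`. -/

variable {n r s : ℕ} (η : Partition n r s) (P : GL (Fin n) ℝ)

/-- Enumeration of the coordinates in the order of the blocks followed by conjugation by `P`. -/
noncomputable def conjReindex :
    Matrix η.Index η.Index ℝ ≃ₐ[ℝ] Matrix (Fin n) (Fin n) ℝ :=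
  (Matrix.reindexAlgEquiv ℝ ℝ η.indexEquiv).trans
    (MulSemiringAction.toAlgEquiv ℝ (Matrix (Fin n) (Fin n) ℝ) (ConjAct.toConjAct P))

/-- The change of coordinates on vectors that corresponds to `conjReindex`. -/
def vecReindex (v : η.Index → ℝ) : Fin n → ℝ :=
  (P : Matrix (Fin n) (Fin n) ℝ) *ᵥ (v ∘ η.indexEquiv.symm)

theorem conjReindex_apply (M : Matrix η.Index η.Index ℝ) :
    conjReindex η P M = (P : Matrix (Fin n) (Fin n) ℝ) *
      M.submatrix η.indexEquiv.symm η.indexEquiv.symm *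
        ((P⁻¹ : GL (Fin n) ℝ) : Matrix (Fin n) (Fin n) ℝ) := rfl

theorem conjReindex_mulVec (M : Matrix η.Index η.Index ℝ) (v : η.Index → ℝ) :
    conjReindex η P M *ᵥ vecReindex η P v = vecReindex η P (M *ᵥ v) := by
  rw [conjReindex_apply, vecReindex, vecReindex, Matrix.mulVec_mulVec, mul_assoc, mul_assoc,
    Units.inv_mul, mul_one, ← Matrix.mulVec_mulVec, Matrix.submatrix_mulVec_equiv,
    Equiv.symm_symm, Function.comp_assoc, Equiv.symm_comp_self, Function.comp_id]

theorem vecReindex_injective : Function.Injective (vecReindex η P) := by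
  intro v w h
  have h1 := congrArg (fun x => ((P⁻¹ : GL (Fin n) ℝ) : Matrix (Fin n) (Fin n) ℝ) *ᵥ x) h
  simp only [vecReindex, Matrix.mulVec_mulVec, Units.inv_mul, Matrix.one_mulVec] at h1
  exact η.indexEquiv.symm.surjective.injective_comp_right h1

theorem vecReindex_comp (v : Fin n → ℝ) :
    vecReindex η P (v ∘ η.indexEquiv) = (P : Matrix (Fin n) (Fin n) ℝ) *ᵥ v := by
  rw [vecReindex, Function.comp_assoc, Equiv.self_comp_symm, Function.comp_id]

theorem exp_conjReindex (M : Matrix η.Index η.Index ℝ) :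
    exp (conjReindex η P M) = conjReindex η P (exp M) := by
  let _ : NormedRing (Matrix η.Index η.Index ℝ) := Matrix.linftyOpNormedRing
  let _ : NormedAlgebra ℝ (Matrix η.Index η.Index ℝ) := Matrix.linftyOpNormedAlgebra
  let _ : NormedAlgebra ℚ (Matrix η.Index η.Index ℝ) := NormedAlgebra.restrictScalars ℚ ℝ _
  let _ : NormedRing (Matrix (Fin n) (Fin n) ℝ) := Matrix.linftyOpNormedRing
  let _ : NormedAlgebra ℝ (Matrix (Fin n) (Fin n) ℝ) := Matrix.linftyOpNormedAlgebra
  exact (map_exp (conjReindex η P)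
    (LinearMap.continuous_of_finiteDimensional (conjReindex η P).toLinearMap) M).symm

/-- `P 𝒦_{η,r,s}(ℝ) P⁻¹` as a subalgebra. -/
noncomputable def conjAlgebra : Subalgebra ℝ (Matrix (Fin n) (Fin n) ℝ) :=
  (blockAlgebra η).map (conjReindex η P).toAlgHom

theorem mem_conjAlgebra {B : Matrix (Fin n) (Fin n) ℝ} :
    B ∈ conjAlgebra η P ↔ ∃ M ∈ blockAlgebra η, conjReindex η P M = B := Iff.rfl

theorem mem_KSet_iff {M : Matrix (Fin n) (Fin n) ℝ} :
    M ∈ KSet η ↔ M.submatrix η.indexEquiv η.indexEquiv ∈ blockAlgebra η :=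
  mem_blockAlgebra_iff.symm

theorem coe_conjAlgebra : (conjAlgebra η P : Set (Matrix (Fin n) (Fin n) ℝ)) = conjKSet η P := by
  ext B
  constructor
  · rintro ⟨M, hM, rfl⟩
    refine ⟨M.submatrix η.indexEquiv.symm η.indexEquiv.symm, ?_, rfl⟩
    rw [mem_KSet_iff, Matrix.submatrix_submatrix, Equiv.symm_comp_self, Matrix.submatrix_id_id]
    exact hM
  · rintro ⟨M, hM, rfl⟩
    refine ⟨_, (mem_KSet_iff η).1 hM, ?_⟩
    change conjReindex η P _ = _
    rw [conjReindex_apply, Matrix.submatrix_submatrix, Equiv.self_comp_symm, Matrix.submatrix_id_id]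

theorem mem_conjAlgebra_of_conj_mem_KStar {A : GL (Fin n) ℝ} (h : P⁻¹ * A * P ∈ KStar η) :
    (A : Matrix (Fin n) (Fin n) ℝ) ∈ conjAlgebra η P := by
  rw [← SetLike.mem_coe, coe_conjAlgebra]
  refine ⟨_, h, ?_⟩
  simp only [← Units.val_mul]
  congr 1
  group

/-- `2π ∑ t_l J_l`, where `J_l` is the complex structure of the `l`-th complex block. -/
noncomputable def period (t : Fin s → ℤ) : Matrix (Fin n) (Fin n) ℝ :=
  conjReindex η P (∑ l, (2 * Real.pi * (t l : ℝ)) • cplxUnit η l)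

theorem period_mem_conjAlgebra (t : Fin s → ℤ) : period η P t ∈ conjAlgebra η P := by
  refine ⟨_, ?_, rfl⟩
  rw [sum_cplxUnit]
  exact scalarHom_mem_blockAlgebra _

theorem exp_period (t : Fin s → ℤ) : exp (period η P t) = 1 := by
  rw [period, exp_conjReindex, exp_sum_two_pi_cplxUnit, map_one]

/-- This is where the vectors `f^{(l)}` come from: `i` sends the first basis vector of a complex
block to the second. -/
theorem cplxUnit_mulVec (l : Fin s) :
    cplxUnit η l *ᵥ (u₀ η ∘ η.indexEquiv) = f η l ∘ η.indexEquiv := by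
  ext x
  obtain (⟨k, a⟩ | ⟨l', j, i⟩) := x
  · simp [cplxUnit, scalarHom_mulVec_inl, f]
  · rw [cplxUnit, scalarHom_mulVec_inr]
    by_cases hl : l' = l
    · subst hl
      fin_cases i <;> simp [u₀, f]
    · fin_cases i <;> simp [u₀, f, hl]

theorem period_mulVec (t : Fin s → ℤ) :
    period η P t *ᵥ v₀ η P =
      ∑ l, (2 * Real.pi * (t l : ℝ)) • ((P : Matrix (Fin n) (Fin n) ℝ) *ᵥ f η l) := by
  rw [period, map_sum, Matrix.sum_mulVec]
  refine Finset.sum_congr rfl fun l _ => ?_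
  rw [map_smul, Matrix.smul_mulVec, v₀, ← vecReindex_comp, conjReindex_mulVec, cplxUnit_mulVec,
    vecReindex_comp]

variable {η P} {X Y : Matrix (Fin n) (Fin n) ℝ}

theorem commute_period (hX : X ∈ conjAlgebra η P) (t : Fin s → ℤ) :
    Commute (period η P t) X := by
  obtain ⟨X, hX, rfl⟩ := hX
  rw [period, sum_cplxUnit]
  exact (commute_scalarHom_of_mem_blockAlgebra hX _).map (conjReindex η P)

theorem commute_of_commute_exp_of_mem_conjAlgebra (hX : X ∈ conjAlgebra η P)
    (hY : Y ∈ conjAlgebra η P) (h : Commute (exp X) (exp Y)) : Commute X Y := by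
  obtain ⟨X, hX', rfl⟩ := mem_conjAlgebra η P |>.1 hX
  obtain ⟨Y, hY', rfl⟩ := mem_conjAlgebra η P |>.1 hY
  rw [exp_conjReindex, exp_conjReindex] at h
  exact (commute_of_commute_exp hX' hY' (h.of_map (conjReindex η P).injective)).map (conjReindex η P)

theorem exists_eq_add_period (hX : X ∈ conjAlgebra η P) (hY : Y ∈ conjAlgebra η P)
    (h : exp X = exp Y) : ∃ t, X = Y + period η P t := by
  obtain ⟨X, hX', rfl⟩ := mem_conjAlgebra η P |>.1 hX
  obtain ⟨Y, hY', rfl⟩ := mem_conjAlgebra η P |>.1 hY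
  rw [exp_conjReindex, exp_conjReindex] at h
  obtain ⟨t, rfl⟩ := exists_eq_add_of_exp_eq hX' hY' ((conjReindex η P).injective h)
  exact ⟨t, by rw [map_add, period]⟩

theorem isUnit_of_mulVec_eq_v₀ (hX : X ∈ conjAlgebra η P) {v : Fin n → ℝ}
    (h : X *ᵥ v = v₀ η P) : IsUnit X := by
  obtain ⟨M, hM, rfl⟩ := mem_conjAlgebra η P |>.1 hX
  have hv : v = vecReindex η P
      ((((P⁻¹ : GL (Fin n) ℝ) : Matrix (Fin n) (Fin n) ℝ) *ᵥ v) ∘ η.indexEquiv) := by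
    rw [vecReindex_comp, Matrix.mulVec_mulVec, Units.mul_inv, Matrix.one_mulVec]
  rw [hv, conjReindex_mulVec, v₀, ← vecReindex_comp η P (u₀ η)] at h
  refine (isUnit_of_mem_blockAlgebra hM (vecReindex_injective η P h) ?_ ?_).map (conjReindex η P)
  · intro k; simp [u₀, realFirst]
  · intro l; simp [u₀, cplxFirst]

/-! ### Integral combinations of the `B_k` and the description of `g²`. -/

section Generators

variable {G : Subgroup (GL (Fin n) ℝ)} {p : ℕ} {A : Fin p → GL (Fin n) ℝ}
  {B : Fin p → Matrix (Fin n) (Fin n) ℝ}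

/-- Integral linear combinations of matrices. -/
def intComb (B : Fin p → Matrix (Fin n) (Fin n) ℝ) (a : Fin p → ℤ) : Matrix (Fin n) (Fin n) ℝ :=
  ∑ k, (a k : ℝ) • B k

theorem intComb_add (a b : Fin p → ℤ) : intComb B (a + b) = intComb B a + intComb B b := by
  simp [intComb, add_smul, Finset.sum_add_distrib]

theorem intComb_zero : intComb B 0 = 0 := by simp [intComb]

theorem intComb_single (k : Fin p) : intComb B (Pi.single k 1) = B k := by
  rw [intComb, Finset.sum_eq_single k]
  · simp
  · intro j _ hj
    simp [hj]
  · simp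

theorem intComb_mem {C : Subalgebra ℝ (Matrix (Fin n) (Fin n) ℝ)} (hB : ∀ k, B k ∈ C)
    (a : Fin p → ℤ) : intComb B a ∈ C :=
  C.sum_mem fun k _ => C.smul_mem (hB k) _

theorem commute_intComb (hB : ∀ j k, Commute (B j) (B k)) (a b : Fin p → ℤ) :
    Commute (intComb B a) (intComb B b) :=
  Commute.sum_left _ _ _ fun j _ => Commute.sum_right _ _ _ fun k _ =>
    ((hB j k).smul_left _).smul_right _

theorem exp_intComb_add (hB : ∀ j k, Commute (B j) (B k)) (a b : Fin p → ℤ) :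
    exp (intComb B (a + b)) = exp (intComb B a) * exp (intComb B b) := by
  rw [intComb_add, Matrix.exp_add_of_commute _ _ (commute_intComb hB a b)]

theorem exp_intComb_neg_eq_inv (hB : ∀ j k, Commute (B j) (B k)) {a : Fin p → ℤ}
    {x : GL (Fin n) ℝ} (h : exp (intComb B a) = x) :
    exp (intComb B (-a)) = (x⁻¹ : GL (Fin n) ℝ) := by
  refine (Units.inv_eq_of_mul_eq_one_right ?_).symm
  rw [← h, ← exp_intComb_add hB, add_neg_cancel, intComb_zero, exp_zero]

/-- Squaring is multiplicative on the abelian group `G`, so the property passes from the generators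
to their closure. -/
theorem exists_sq_eq_exp_intComb (hG : ∀ x ∈ G, ∀ y ∈ G, x * y = y * x)
    (hA : Subgroup.closure (Set.range A) = G) (hB : ∀ j k, Commute (B j) (B k))
    (hAB : ∀ k, (A k : Matrix (Fin n) (Fin n) ℝ) ^ 2 = exp (B k)) {x : GL (Fin n) ℝ}
    (hx : x ∈ G) : ∃ a, exp (intComb B a) = (x ^ 2 : GL (Fin n) ℝ) := by
  subst hA
  induction hx using Subgroup.closure_induction with
  | mem x hx =>
    obtain ⟨k, rfl⟩ := hx
    exact ⟨Pi.single k 1, by rw [intComb_single, ← hAB, Units.val_pow_eq_pow_val]⟩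
  | one => exact ⟨0, by rw [intComb_zero, exp_zero, one_pow, Units.val_one]⟩
  | mul x y hx hy ihx ihy =>
    obtain ⟨a, ha⟩ := ihx
    obtain ⟨b, hb⟩ := ihy
    have hxy : Commute x y := hG x hx y hy
    exact ⟨a + b, by rw [exp_intComb_add hB, ha, hb, hxy.mul_pow, Units.val_mul]⟩
  | inv x _ ih =>
    obtain ⟨a, ha⟩ := ih
    exact ⟨-a, by rw [exp_intComb_neg_eq_inv hB ha, inv_pow]⟩

theorem exists_exp_intComb_eq_sq (hG : ∀ x ∈ G, ∀ y ∈ G, x * y = y * x)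
    (hA : ∀ k, A k ∈ G) (hB : ∀ j k, Commute (B j) (B k))
    (hAB : ∀ k, (A k : Matrix (Fin n) (Fin n) ℝ) ^ 2 = exp (B k)) (a : Fin p → ℤ) :
    ∃ x ∈ G, exp (intComb B a) = (x ^ 2 : GL (Fin n) ℝ) := by
  -- The admissible exponent vectors form a subgroup of `ℤ^p` containing the standard basis.
  let S : AddSubgroup (Fin p → ℤ) :=
    { carrier := {a | ∃ x ∈ G, exp (intComb B a) = (x ^ 2 : GL (Fin n) ℝ)}
      zero_mem' := ⟨1, G.one_mem, by rw [intComb_zero, exp_zero, one_pow, Units.val_one]⟩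
      add_mem' := by
        rintro a b ⟨x, hx, ha⟩ ⟨y, hy, hb⟩
        have hxy : Commute x y := hG x hx y hy
        exact ⟨x * y, G.mul_mem hx hy,
          by rw [exp_intComb_add hB, ha, hb, hxy.mul_pow, Units.val_mul]⟩
      neg_mem' := by
        rintro a ⟨x, hx, ha⟩
        exact ⟨x⁻¹, G.inv_mem hx, by rw [exp_intComb_neg_eq_inv hB ha, inv_pow]⟩ }
  have ha : a = ∑ k, a k • (Pi.single k 1 : Fin p → ℤ) := by
    ext k
    simp [Finset.sum_apply, Pi.single_apply]
  change a ∈ S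
  rw [ha]
  refine S.sum_mem fun k _ => S.zsmul_mem ⟨A k, hA k, ?_⟩ _
  rw [intComb_single, ← hAB, Units.val_pow_eq_pow_val]

theorem intComb_add_period_mulVec (a : Fin p → ℤ) (t : Fin s → ℤ) :
    (intComb B a + period η P t) *ᵥ v₀ η P = ∑ k, (a k : ℝ) • (B k *ᵥ v₀ η P) +
      ∑ l, (2 * Real.pi * (t l : ℝ)) • ((P : Matrix (Fin n) (Fin n) ℝ) *ᵥ f η l) := by
  rw [Matrix.add_mulVec, period_mulVec, intComb, Matrix.sum_mulVec]
  simp only [Matrix.smul_mulVec]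

theorem explicitSubgroup_eq_image :
    explicitSubgroup η P B = (fun M => M *ᵥ v₀ η P) ''
      {M | ∃ a t, M = intComb B a + period η P t} := by
  ext x
  constructor
  · rintro ⟨a, t, rfl⟩
    exact ⟨_, ⟨a, t, rfl⟩, intComb_add_period_mulVec a t⟩
  · rintro ⟨_, ⟨a, t, rfl⟩, rfl⟩
    exact ⟨a, t, intComb_add_period_mulVec a t⟩

theorem exp_intComb_add_period (hB : ∀ k, B k ∈ conjAlgebra η P) (a : Fin p → ℤ)
    (t : Fin s → ℤ) : exp (intComb B a + period η P t) = exp (intComb B a) := by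
  rw [Matrix.exp_add_of_commute _ _ (commute_period (intComb_mem hB a) t).symm, exp_period, mul_one]

theorem gSq_eq (hG : ∀ x ∈ G, ∀ y ∈ G, x * y = y * x)
    (hA : Subgroup.closure (Set.range A) = G) (hB : ∀ k, B k ∈ conjAlgebra η P)
    (hBc : ∀ j k, Commute (B j) (B k))
    (hAB : ∀ k, (A k : Matrix (Fin n) (Fin n) ℝ) ^ 2 = exp (B k)) :
    gSq η P G = {M | ∃ a t, M = intComb B a + period η P t} := by
  ext M
  rw [gSq, logSet, ← coe_conjAlgebra]
  constructor
  · rintro ⟨⟨_, ⟨x, hx, rfl⟩, hM⟩, hMK⟩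
    obtain ⟨a, ha⟩ := exists_sq_eq_exp_intComb hG hA hBc hAB hx
    obtain ⟨t, ht⟩ := exists_eq_add_period hMK (intComb_mem hB a) (hM.trans ha.symm)
    exact ⟨a, t, ht⟩
  · rintro ⟨a, t, rfl⟩
    have hAG : ∀ k, A k ∈ G := fun k => hA ▸ Subgroup.subset_closure ⟨k, rfl⟩
    obtain ⟨x, hx, h⟩ := exists_exp_intComb_eq_sq hG hAG hBc hAB a
    exact ⟨⟨_, ⟨x, hx, rfl⟩, (exp_intComb_add_period hB a t).trans h⟩,
      add_mem (intComb_mem hB a) (period_mem_conjAlgebra η P t)⟩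

end Generators

/-! ### From a locally dense orbit to density at `v₀`, and the main theorem. -/

theorem adjoin_mul_comm {S : Set (Matrix (Fin n) (Fin n) ℝ)}
    (hS : ∀ x ∈ S, ∀ y ∈ S, x * y = y * x) :
    ∀ x ∈ Algebra.adjoin ℝ S, ∀ y ∈ Algebra.adjoin ℝ S, x * y = y * x := fun _ hx _ hy =>
  have h := Algebra.adjoin_le_centralizer_centralizer ℝ S
  Set.centralizer_centralizer_comm_of_comm hS _ (h hx) _ (h hy)

/-- A locally dense orbit makes the squares of the logarithms dense at the distinguished vector. -/
theorem dense_evalSet_gSq_of_locallyDense_orbit {G : Subgroup (GL (Fin n) ℝ)}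
    (hG : ∀ x ∈ G, ∀ y ∈ G, x * y = y * x) (hP : ∀ x ∈ G, P⁻¹ * x * P ∈ KStar η)
    {v : Fin n → ℝ} (hv : LocallyDense (orbit G v)) :
    Dense (evalSet (gSq η P G) (v₀ η P)) := by
  let C := Algebra.adjoin ℝ {M : Matrix (Fin n) (Fin n) ℝ | ∃ x ∈ G, M = x}
  have hC : ∀ x ∈ C, ∀ y ∈ C, x * y = y * x := by
    refine adjoin_mul_comm ?_
    rintro _ ⟨x, hx, rfl⟩ _ ⟨y, hy, rfl⟩
    rw [← Units.val_mul, hG x hx y hy, Units.val_mul]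
  have hCK : C ≤ conjAlgebra η P := by
    refine Algebra.adjoin_le ?_
    rintro _ ⟨x, hx, rfl⟩
    exact mem_conjAlgebra_of_conj_mem_KStar η P (hP x hx)
  have hGC : ∀ x ∈ G, (x : Matrix (Fin n) (Fin n) ℝ) ∈ C := fun x hx =>
    Algebra.subset_adjoin ⟨x, hx, rfl⟩
  have hsurj : Function.Surjective (evalMap C v) := by
    refine evalMap_surjective_of_locallyDense hv ?_
    rintro _ ⟨x, hx, rfl⟩
    exact ⟨x, hGC x hx, rfl⟩
  obtain ⟨⟨N, hN⟩, hNv⟩ := hsurj (v₀ η P)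
  rw [evalMap_apply] at hNv
  -- From here on `v₀ = U v` with `U` invertible in `C`.
  obtain ⟨U, rfl⟩ := isUnit_of_mulVec_eq_v₀ (hCK hN) hNv
  have hU : Function.Surjective fun x : Fin n → ℝ =>
      (U : Matrix (Fin n) (Fin n) ℝ) *ᵥ ((2 : ℝ) • x) := fun y =>
    ⟨(2 : ℝ)⁻¹ • (((U⁻¹ : GL (Fin n) ℝ) : Matrix (Fin n) (Fin n) ℝ) *ᵥ y), by
      simp [smul_smul, Matrix.mulVec_mulVec]⟩
  have hcont : Continuous fun x : Fin n → ℝ =>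
      (U : Matrix (Fin n) (Fin n) ℝ) *ᵥ ((2 : ℝ) • x) := by fun_prop
  refine (hU.denseRange.dense_image hcont (dense_log_of_locallyDense_orbit hC hGC hv)).mono ?_
  rintro _ ⟨_, ⟨X, ⟨hX, x, hx, hXx⟩, rfl⟩, rfl⟩
  -- Doubling a logarithm of `x` gives one of `x ^ 2`; it commutes with `U` since both lie in `C`,
  -- so its value at `v₀` is `U (2 X v)`.
  refine ⟨(2 : ℝ) • X, ⟨⟨x ^ 2, ⟨x, hx, rfl⟩, ?_⟩, ?_⟩, ?_⟩
  · rw [two_smul, Matrix.exp_add_of_commute _ _ (Commute.refl X), hXx, sq, Units.val_mul]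
  · rw [← coe_conjAlgebra]
    exact (conjAlgebra η P).smul_mem (hCK hX) 2
  · change ((2 : ℝ) • X) *ᵥ v₀ η P = (U : Matrix (Fin n) (Fin n) ℝ) *ᵥ ((2 : ℝ) • (X *ᵥ v))
    rw [← hNv, Matrix.mulVec_smul, Matrix.smul_mulVec, Matrix.mulVec_mulVec, Matrix.mulVec_mulVec,
      hC X hX U hN]

end AbelianLinear

theorem theorem1p4 {n r s p : ℕ} (hn : 1 ≤ n) (η : AbelianLinear.Partition n r s)
    (G : Subgroup (GL (Fin n) ℝ)) (hG : ∀ A ∈ G, ∀ A' ∈ G, A * A' = A' * A)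
    (P : GL (Fin n) ℝ) (hP : ∀ A ∈ G, P⁻¹ * A * P ∈ AbelianLinear.KStar η)
    (A : Fin p → GL (Fin n) ℝ) (hA : Subgroup.closure (Set.range A) = G)
    (B : Fin p → Matrix (Fin n) (Fin n) ℝ) (hB : ∀ k, B k ∈ AbelianLinear.g η P G)
    (hAB : ∀ k, (A k : Matrix (Fin n) (Fin n) ℝ) ^ 2 = NormedSpace.exp (B k)) :
    AbelianLinear.evalSet (AbelianLinear.gSq η P G) (AbelianLinear.v₀ η P) =
        AbelianLinear.explicitSubgroup η P B ∧
      List.TFAE [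
        ∃ v : Fin n → ℝ, AbelianLinear.LocallyDense (AbelianLinear.orbit G v),
        AbelianLinear.LocallyDense (AbelianLinear.orbit G (AbelianLinear.v₀ η P)),
        Dense (AbelianLinear.explicitSubgroup η P B)] := by
  open AbelianLinear in
  have hBK : ∀ k, B k ∈ conjAlgebra η P := fun k => by
    rw [← SetLike.mem_coe, coe_conjAlgebra]
    exact (hB k).2
  -- The exponentials of the `B_k` lie in the abelian group `G`.
  have hBc : ∀ j k, Commute (B j) (B k) := fun j k => by
    obtain ⟨⟨x, hx, hjx⟩, -⟩ := hB j
    obtain ⟨⟨y, hy, hky⟩, -⟩ := hB k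
    refine commute_of_commute_exp_of_mem_conjAlgebra (hBK j) (hBK k) ?_
    rw [hjx, hky]
    exact congrArg Units.val (hG x hx y hy)
  have hg := gSq_eq hG hA hBK hBc hAB
  have heq : evalSet (gSq η P G) (v₀ η P) = explicitSubgroup η P B := by
    rw [hg, explicitSubgroup_eq_image, evalSet]
  refine ⟨heq, ?_⟩
  tfae_have 2 → 1 := fun h => ⟨_, h⟩
  tfae_have 1 → 3 := fun ⟨v, hv⟩ => heq ▸ dense_evalSet_gSq_of_locallyDense_orbit hG hP hv
  tfae_have 3 → 2 := fun h => by
    rw [explicitSubgroup_eq_image] at h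
    -- Combinations of the commuting `B_k` and the periods generate a commutative algebra, as
    -- periods commute with all of `P 𝒦 P⁻¹`.
    have hC := adjoin_mul_comm (S := {M | ∃ a t, M = intComb B a + period η P t}) (by
      rintro _ ⟨a, t, rfl⟩ _ ⟨b, t', rfl⟩
      have h1 := commute_intComb hBc a b
      exact (h1.add_right (commute_period (intComb_mem hBK a) t').symm).add_left
        (commute_period (add_mem (intComb_mem hBK b) (period_mem_conjAlgebra η P t')) t))
    refine (locallyDense_exp_of_dense hC Algebra.subset_adjoin h).mono
      (interior_mono (closure_mono ?_))
    rintro _ ⟨M, hM, rfl⟩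
    rw [← hg] at hM
    obtain ⟨⟨_, ⟨x, hx, rfl⟩, hMx⟩, -⟩ := hM
    exact ⟨x ^ 2, G.pow_mem hx 2, by rw [← hMx]⟩
  tfae_finish
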